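/- Let $T$ be the rooted tree whose vertices are the finite words over the alphabet $X=\{1,2,3,4\}$ (the root is the empty word and the children of a word $\omega$ are the words $\omega x$ with $x\in X$), and let $\mathrm{Aut}(T)$ be its automorphism group. For $f\in\mathrm{Aut}(T)$ and a vertex $\omega$, the section $f_\omega\in\mathrm{Aut}(T)$ is defined by $f(\omega v)=f(\omega)f_\omega(v)$ for all words $v$. Let $a\in\mathrm{Aut}(T)$ be the rooted automorphism $xv\mapsto \sigma(x)v$ with $\sigma=(1\ 2\ 3\ 4)$, and let $b\in\mathrm{Aut}(T)$ be the automorphism that fixes the first-level vertices and is recursively defined by its first-level sections $(b_1,b_2,b_3,b_4)=(a,1,a,b)$. Let $\mathcal G=\langle a,b\rangle\le\mathrm{Aut}(T)$ be the second Grigorchuk group, and let $\mathrm{St}_{\mathcal G}(n)$ be the subgroup of all elements of $\mathcal G$ that fix every vertex of level $n$ (that is, every word of length $n$). Then: (i) $\mathcal G$ is super strongly fractal: for every integer $n\ge 0$ and every word $\omega$ of length $n$, $\{f_\omega : f\in \mathrm{St}_{\mathcal G}(n)\}=\mathcal G$; (ii) the automorphism group of $\mathcal G$ equals its normaliser in $\mathrm{Aut}(T)$,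 in the sense that the homomorphism $N_{\mathrm{Aut}(T)}(\mathcal G)\to\mathrm{Aut}(\mathcal G)$ sending $g$ to the conjugation $h\mapsto ghg^{-1}$ is an isomorphism. -/

import Mathlib

/-- The group of automorphisms of the rooted tree whose vertices are the finite words over the
alphabet `X`: the root is the empty word, the children of `w` are the words `w ++ [x]`, and `u`
precedes `v` when `u` is a prefix of `v`.  An automorphism of the rooted tree is a bijection of the
vertices that preserves this precedence in both directions.  Multiplication is composition,
`(f * g) w = f (g w)`. -/
abbrev TreeAut (X : Type*) : Type _ :=
  ((· <+: ·) : List X → List X → Prop) ≃r ((· <+: ·) : List X → List X → Prop)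

namespace TreeAut

variable {X : Type*}

theorem length_le_length_apply (f : TreeAut X) (w : List X) : w.length ≤ (f w).length := by
  induction w using List.reverseRecOn with
  | nil => simp
  | append_singleton u x ih =>
    have h : f u <+: f (u ++ [x]) := f.map_rel_iff.2 (List.prefix_append u [x])
    have hne : (f u).length ≠ (f (u ++ [x])).length := by
      intro he
      have h1 := f.injective (h.eq_of_length he)
      simp at h1
    have := h.length_le
    simp only [List.length_append, List.length_singleton]
    omega

/-- Tree automorphisms preserve the levels of the tree. -/
theorem length_apply (f : TreeAut X) (w : List X) : (f w).length = w.length := by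
  apply le_antisymm _ (length_le_length_apply f w)
  simpa using length_le_length_apply f.symm (f w)

theorem apply_append (f : TreeAut X) (u v : List X) :
    f (u ++ v) = f u ++ (f (u ++ v)).drop u.length := by
  obtain ⟨t, ht⟩ : f u <+: f (u ++ v) := f.map_rel_iff.2 (List.prefix_append u v)
  rw [← ht, ← length_apply f u, List.drop_left]

theorem symm_apply_append (f : TreeAut X) (u v : List X) :
    f (u ++ (f.symm (f u ++ v)).drop u.length) = f u ++ v := by
  have h := apply_append f.symm (f u) v
  rw [length_apply, RelIso.symm_apply_apply] at h
  rw [← h, RelIso.apply_symm_apply]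

/-- The section `f_u` of a tree automorphism `f` at the vertex `u`: the automorphism `f_u` such
that `f (u ++ v) = f u ++ f_u v` for all words `v`. -/
def sectionAt (f : TreeAut X) (u : List X) : TreeAut X where
  toFun v := (f (u ++ v)).drop u.length
  invFun v := (f.symm (f u ++ v)).drop u.length
  left_inv v := by
    dsimp only
    rw [← apply_append, RelIso.symm_apply_apply, List.drop_left]
  right_inv v := by
    dsimp only
    rw [symm_apply_append, ← length_apply f u, List.drop_left]
  map_rel_iff' {v w} := by
    dsimp only [Equiv.coe_fn_mk]
    rw [← List.prefix_append_right_inj (f u), ← apply_append, ← apply_append, f.map_rel_iff,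
      List.prefix_append_right_inj]

/-- The defining property of the section. -/
theorem apply_append_eq_sectionAt (f : TreeAut X) (u v : List X) :
    f (u ++ v) = f u ++ f.sectionAt u v :=
  apply_append f u v

/-- The `n`th level stabiliser `St_G(n)`: the elements of `G` that fix every vertex of level `n`. -/
def levelStabilizer (G : Subgroup (TreeAut X)) (n : ℕ) : Subgroup (TreeAut X) where
  carrier := {f | f ∈ G ∧ ∀ w : List X, w.length = n → f w = w}
  one_mem' := ⟨G.one_mem, fun _ _ => rfl⟩
  mul_mem' {f g} hf hg := ⟨G.mul_mem hf.1 hg.1, fun w hw => by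
    rw [RelIso.mul_apply, hg.2 w hw, hf.2 w hw]⟩
  inv_mem' {f} hf := ⟨G.inv_mem hf.1, fun w hw => by
    conv_lhs => rw [← hf.2 w hw]
    exact f.symm_apply_apply w⟩

/-- `G` is super strongly fractal: for each `n` and each vertex `ω` of level `n`, the map
`φ_ω : f ↦ f_ω` satisfies `φ_ω(St_G(n)) = G`. -/
def IsSuperStronglyFractal (G : Subgroup (TreeAut X)) : Prop :=
  ∀ (n : ℕ) (ω : List X), ω.length = n →
    (fun f : TreeAut X => f.sectionAt ω) '' (levelStabilizer G n : Set (TreeAut X))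
      = (G : Set (TreeAut X))

/-- The rooted automorphism given by a permutation `σ` of the alphabet: it permutes the maximal
subtrees rooted at the first level vertices, `x w ↦ σ(x) w`. -/
def rooted (σ : Equiv.Perm X) : TreeAut X where
  toFun
    | [] => []
    | x :: w => σ x :: w
  invFun
    | [] => []
    | x :: w => σ.symm x :: w
  left_inv w := by cases w <;> simp
  right_inv w := by cases w <;> simp
  map_rel_iff' {v w} := by
    cases v <;> cases w <;> simp [List.cons_prefix_cons]

end TreeAut

namespace SecondGrigorchuk

open TreeAut

/-- The generator `a`: the rooted automorphism given by the `4`-cycle `x ↦ x + 1`.  The letters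
`1, 2, 3, 4` of the alphabet are written `0, 1, 2, 3`. -/
def a : TreeAut (Fin 4) := rooted (finRotate 4)

/-- The action on words of the automorphism `b = (a, 1, a, b)`. -/
def bFun : List (Fin 4) → List (Fin 4)
  | [] => []
  | 0 :: w => 0 :: a w
  | 1 :: w => 1 :: w
  | 2 :: w => 2 :: a w
  | 3 :: w => 3 :: bFun w

/-- The action on words of the inverse `(a⁻¹, 1, a⁻¹, b⁻¹)` of `b`. -/
def bInvFun : List (Fin 4) → List (Fin 4)
  | [] => []
  | 0 :: w => 0 :: a.symm w
  | 1 :: w => 1 :: w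
  | 2 :: w => 2 :: a.symm w
  | 3 :: w => 3 :: bInvFun w

theorem bInvFun_bFun (w : List (Fin 4)) : bInvFun (bFun w) = w := by
  induction w with
  | nil => rfl
  | cons x w ih => fin_cases x <;> simp [bFun, bInvFun, ih]

theorem bFun_bInvFun (w : List (Fin 4)) : bFun (bInvFun w) = w := by
  induction w with
  | nil => rfl
  | cons x w ih => fin_cases x <;> simp [bFun, bInvFun, ih]

theorem bFun_prefix_iff (v w : List (Fin 4)) : bFun v <+: bFun w ↔ v <+: w := by
  induction v generalizing w with
  | nil => simp [bFun]
  | cons x v ih =>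
    cases w with
    | nil => fin_cases x <;> simp [bFun]
    | cons y w =>
      fin_cases x <;> fin_cases y <;> simp [bFun, List.cons_prefix_cons, ih, a.map_rel_iff]

/-- The generator `b`: it fixes the first level vertices and is defined recursively by
`ψ(b) = (a, 1, a, b)`. -/
def b : TreeAut (Fin 4) where
  toFun := bFun
  invFun := bInvFun
  left_inv := bInvFun_bFun
  right_inv := bFun_bInvFun
  map_rel_iff' {v w} := bFun_prefix_iff v w

/-- The second Grigorchuk group, generated by `a` and `b`. -/
def group : Subgroup (TreeAut (Fin 4)) := Subgroup.closure {a, b}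

end SecondGrigorchuk

/-!
The derived series `G = G⁽⁰⁾ ≥ G⁽¹⁾ ≥ …` of the second Grigorchuk group `G` carries the whole
argument.  Elements of `G` rotate the first level, so `G⁽¹⁾` fixes it, and the first level sections
of `⁅a, b⁆` and its conjugates by `a` show that the section at any letter maps `G⁽¹⁾` onto `G`.
Since sections are homomorphisms on stabilisers, induction gives that `G⁽ⁿ⁾` fixes the `n`th level
(`SecondGrigorchuk.derived_fixes`) and that the section at any vertex of this level maps `G⁽ⁿ⁾`
onto `G` (`SecondGrigorchuk.group_le_sections_derived`).  This is super strong fractality, in a form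
in which the level stabilisers are replaced by characteristic subgroups.

For the automorphisms of `G`, the method is that of Lavreniuk and Nekrashevych for saturated weakly
branch groups.  As `G` is level transitive, `G⁽ⁿ⁾` is transitive on the levels of each subtree below
a vertex of level `n`.  Moreover a copy of `G⁽²⁾` acting below a single letter lies in `G`
(`SecondGrigorchuk.map_belowLetter_derived_two_le`), hence a copy of `G⁽ᵐ⁺²⁾` lies in `G⁽ᵐ⁾`, and so
`G⁽ⁿ⁾` has noncommuting elements supported below any given vertex.  If `g` commutes with all
`G⁽ⁿ⁾`-conjugates of `h`, then below each vertex of level `n` one of the two acts trivially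
(`TreeAut.fixes_below_or_fixes_below`).  An automorphism `α` of `G` preserves `G⁽ⁿ⁾` and this
commutation relation, which holds for elements of `G⁽ⁿ⁾` supported below distinct vertices of
level `n`.  Counting vertices, `α` maps the elements of `G⁽ⁿ⁾` supported below `v` to elements
supported below a single vertex of the same level (`TreeAut.IsSaturating.exists_image`).  These
vertices define a tree automorphism that induces `α`; it is unique because an automorphism
commuting with `G` preserves the supports of all elements of `G`.
-/

namespace TreeAut

open scoped commutatorElement

variable {X : Type*}

/-! ### Commutators -/

theorem commutatorElement_mem {Γ : Type*} [Group Γ] {H : Subgroup Γ} {f g : Γ} (hf : f ∈ H)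
    (hg : g ∈ H) : ⁅f, g⁆ ∈ H :=
  H.mul_mem (H.mul_mem (H.mul_mem hf hg) (H.inv_mem hf)) (H.inv_mem hg)

/-- A subgroup `N` normalised by `⟨S⟩` contains the commutator subgroup of `⟨S⟩` as soon as it
contains the commutators of elements of `S`. -/
theorem commutator_closure_le {Γ : Type*} [Group Γ] {S : Set Γ} {N : Subgroup Γ}
    (hN : ∀ g ∈ Subgroup.closure S, ∀ n ∈ N, g * n * g⁻¹ ∈ N)
    (hS : ∀ s ∈ S, ∀ t ∈ S, ⁅s, t⁆ ∈ N) :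
    ⁅Subgroup.closure S, Subgroup.closure S⁆ ≤ N := by
  have key : ∀ s : Γ, (∀ t ∈ S, ⁅s, t⁆ ∈ N) → ∀ h ∈ Subgroup.closure S, ⁅s, h⁆ ∈ N := by
    intro s hs h hh
    induction hh using Subgroup.closure_induction with
    | mem t ht => exact hs t ht
    | one => rw [commutatorElement_one_right]; exact N.one_mem
    | mul g h hg _ hg' hh' =>
      rw [commutatorElement_mul_right_eq_mul_conj, mul_assoc, mul_assoc, ← mul_assoc g]
      exact N.mul_mem hg' (hN g hg _ hh')
    | inv h hh hh' =>
      rw [commutatorElement_inv_right, ← commutatorElement_inv]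
      simpa using hN _ (inv_mem hh) _ (N.inv_mem hh')
  rw [Subgroup.commutator_le]
  refine fun g hg => key g fun t ht => ?_
  rw [← commutatorElement_inv]
  exact N.inv_mem (key t (hS t ht) g hg)

/-! ### Sections, fixed vertices and rigid stabilisers -/

theorem map_nil (f : TreeAut X) : f [] = [] :=
  List.length_eq_zero_iff.1 (length_apply f [])

@[simp]
theorem one_sectionAt (u : List X) : (1 : TreeAut X).sectionAt u = 1 := by
  refine RelIso.ext fun v => List.append_cancel_left (as := (1 : TreeAut X) u) ?_
  rw [← apply_append_eq_sectionAt]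
  rfl

theorem mul_sectionAt (f g : TreeAut X) (u : List X) :
    (f * g).sectionAt u = f.sectionAt (g u) * g.sectionAt u := by
  refine RelIso.ext fun v => List.append_cancel_left (as := (f * g) u) ?_
  rw [← apply_append_eq_sectionAt, RelIso.mul_apply, RelIso.mul_apply, RelIso.mul_apply,
    apply_append_eq_sectionAt g, apply_append_eq_sectionAt f]

theorem inv_sectionAt_apply (f : TreeAut X) (u : List X) :
    f⁻¹.sectionAt (f u) = (f.sectionAt u)⁻¹ := by
  rw [eq_inv_iff_mul_eq_one, ← mul_sectionAt, inv_mul_cancel, one_sectionAt]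

theorem sectionAt_nil (f : TreeAut X) : f.sectionAt [] = f :=
  RelIso.ext fun _ => rfl

theorem sectionAt_sectionAt (f : TreeAut X) (u v : List X) :
    (f.sectionAt u).sectionAt v = f.sectionAt (u ++ v) := by
  refine RelIso.ext fun w => List.append_cancel_left (as := f (u ++ v)) ?_
  rw [← apply_append_eq_sectionAt f (u ++ v), apply_append_eq_sectionAt f u v, List.append_assoc,
    List.append_assoc, ← apply_append_eq_sectionAt (f.sectionAt u) v,
    ← apply_append_eq_sectionAt f u]

theorem rooted_sectionAt (σ : Equiv.Perm X) (x : X) : (rooted σ).sectionAt [x] = 1 :=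
  RelIso.ext fun _ => rfl

theorem rooted_singleton (σ : Equiv.Perm X) (x : X) : rooted σ [x] = [σ x] :=
  rfl

theorem inv_apply_of_fixed {f : TreeAut X} {u : List X} (hf : f u = u) : f⁻¹ u = u := by
  conv_lhs => rw [← hf]
  exact RelIso.inv_apply_self f u

theorem inv_sectionAt {f : TreeAut X} {u : List X} (hf : f u = u) :
    f⁻¹.sectionAt u = (f.sectionAt u)⁻¹ := by
  rw [← inv_sectionAt_apply, hf]

theorem conj_apply_of_fixed {f : TreeAut X} {u : List X} (hf : f u = u) (g : TreeAut X) :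
    (g * f * g⁻¹) (g u) = g u := by
  rw [RelIso.mul_apply, RelIso.mul_apply, RelIso.inv_apply_self, hf]

theorem conj_sectionAt {f : TreeAut X} {u : List X} (hf : f u = u) (g : TreeAut X) :
    (g * f * g⁻¹).sectionAt (g u) = g.sectionAt u * f.sectionAt u * (g.sectionAt u)⁻¹ := by
  rw [mul_sectionAt, inv_sectionAt_apply, RelIso.inv_apply_self, mul_sectionAt, hf]

theorem commutator_apply_of_fixed {f g : TreeAut X} {u : List X} (hf : f u = u) (hg : g u = u) :
    ⁅f, g⁆ u = u := by
  rw [commutatorElement_def, RelIso.mul_apply, RelIso.mul_apply, RelIso.mul_apply,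
    inv_apply_of_fixed hg, inv_apply_of_fixed hf, hg, hf]

theorem commutator_sectionAt {f g : TreeAut X} {u : List X} (hf : f u = u) (hg : g u = u) :
    ⁅f, g⁆.sectionAt u = ⁅f.sectionAt u, g.sectionAt u⁆ := by
  rw [commutatorElement_def, commutatorElement_def, mul_sectionAt, mul_sectionAt, mul_sectionAt,
    inv_apply_of_fixed hg, inv_apply_of_fixed hf, hg, inv_sectionAt hg, inv_sectionAt hf]

/-- A tree automorphism is determined by its action on the first level and its first level
sections. -/
theorem ext_firstLevel {f g : TreeAut X} (h : ∀ x, f [x] = g [x])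
    (hs : ∀ x, f.sectionAt [x] = g.sectionAt [x]) : f = g := by
  refine RelIso.ext fun w => ?_
  cases w with
  | nil => rw [map_nil, map_nil]
  | cons x w =>
    have hf := apply_append_eq_sectionAt f [x] w
    have hg := apply_append_eq_sectionAt g [x] w
    rw [h, hs, ← hg] at hf
    exact hf

theorem apply_eq_of_prefix {f : TreeAut X} {u w : List X} (h : u <+: w) (hw : f w = w) :
    f u = u := by
  have h' : f u <+: w := hw ▸ f.map_rel_iff.2 h
  exact (List.prefix_of_prefix_length_le h' h (length_apply f u).le).eq_of_length
    (length_apply f u)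

theorem exists_apply_ne {f : TreeAut X} (hf : f ≠ 1) : ∃ w, f w ≠ w := by
  by_contra! h
  exact hf (RelIso.ext h)

/-- The sections at `u` of the elements of `H` that fix the vertex `u`. -/
def sections (H : Subgroup (TreeAut X)) (u : List X) : Subgroup (TreeAut X) where
  carrier := {k | ∃ f ∈ H, f u = u ∧ f.sectionAt u = k}
  one_mem' := ⟨1, H.one_mem, rfl, one_sectionAt u⟩
  mul_mem' := by
    rintro _ _ ⟨f, hf, hfu, rfl⟩ ⟨g, hg, hgu, rfl⟩
    exact ⟨f * g, H.mul_mem hf hg, by rw [RelIso.mul_apply, hgu, hfu],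
      by rw [mul_sectionAt, hgu]⟩
  inv_mem' := by
    rintro _ ⟨f, hf, hfu, rfl⟩
    exact ⟨f⁻¹, H.inv_mem hf, inv_apply_of_fixed hfu, inv_sectionAt hfu⟩

theorem commutator_sections_le (H K : Subgroup (TreeAut X)) (u : List X) :
    ⁅sections H u, sections K u⁆ ≤ sections ⁅H, K⁆ u := by
  rw [Subgroup.commutator_le]
  rintro _ ⟨f, hf, hfu, rfl⟩ _ ⟨g, hg, hgu, rfl⟩
  exact ⟨⁅f, g⁆, Subgroup.commutator_mem_commutator hf hg, commutator_apply_of_fixed hfu hgu,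
    commutator_sectionAt hfu hgu⟩

theorem sections_sections_le (H : Subgroup (TreeAut X)) (u v : List X) :
    sections (sections H u) v ≤ sections H (u ++ v) := by
  rintro _ ⟨_, ⟨f, hf, hfu, rfl⟩, hv, rfl⟩
  have hfuv : f (u ++ v) = u ++ v := by rw [apply_append_eq_sectionAt, hfu, hv]
  exact ⟨f, hf, hfuv, (sectionAt_sectionAt f u v).symm⟩

theorem sections_mono {H K : Subgroup (TreeAut X)} (h : H ≤ K) (u : List X) :
    sections H u ≤ sections K u := by
  rintro _ ⟨f, hf, hfu, rfl⟩
  exact ⟨f, h hf, hfu, rfl⟩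

/-- The automorphisms that fix the first level and whose section at each letter `x` lies in
`K x`. -/
def firstLevel (K : X → Subgroup (TreeAut X)) : Subgroup (TreeAut X) where
  carrier := {f | ∀ x, f [x] = [x] ∧ f.sectionAt [x] ∈ K x}
  one_mem' x := ⟨rfl, by rw [one_sectionAt]; exact (K x).one_mem⟩
  mul_mem' {f g} hf hg x := ⟨by rw [RelIso.mul_apply, (hg x).1, (hf x).1],
    by rw [mul_sectionAt, (hg x).1]; exact (K x).mul_mem (hf x).2 (hg x).2⟩
  inv_mem' {f} hf x := ⟨inv_apply_of_fixed (hf x).1,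
    by rw [inv_sectionAt (hf x).1]; exact (K x).inv_mem (hf x).2⟩

theorem commutator_firstLevel_le (K L : X → Subgroup (TreeAut X)) :
    ⁅firstLevel K, firstLevel L⁆ ≤ firstLevel fun x => ⁅K x, L x⁆ := by
  rw [Subgroup.commutator_le]
  intro f hf g hg x
  refine ⟨commutator_apply_of_fixed (hf x).1 (hg x).1, ?_⟩
  rw [commutator_sectionAt (hf x).1 (hg x).1]
  exact Subgroup.commutator_mem_commutator (hf x).2 (hg x).2

/-- The rigid stabiliser of the vertex `u` in the full automorphism group: the automorphisms that
fix every vertex outside the subtree below `u`. -/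
def rigidStabilizer (u : List X) : Subgroup (TreeAut X) where
  carrier := {f | ∀ w, ¬ u <+: w → f w = w}
  one_mem' _ _ := rfl
  mul_mem' {f g} hf hg w hw := by rw [RelIso.mul_apply, hg w hw, hf w hw]
  inv_mem' {f} hf w hw := inv_apply_of_fixed (hf w hw)

theorem prefix_apply_of_mem_rigidStabilizer {f : TreeAut X} {u w : List X}
    (hf : f ∈ rigidStabilizer u) (hw : u <+: w) : u <+: f w := by
  by_contra h
  exact h (by rwa [f.injective (hf _ h)])

theorem rigidStabilizer_anti {u v : List X} (h : u <+: v) :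
    rigidStabilizer v ≤ rigidStabilizer u :=
  fun _ hf w hw => hf w fun hvw => hw (h.trans hvw)

theorem conj_mem_rigidStabilizer {f : TreeAut X} {u : List X} (hf : f ∈ rigidStabilizer u)
    (g : TreeAut X) : g * f * g⁻¹ ∈ rigidStabilizer (g u) := by
  intro w hw
  rw [RelIso.mul_apply, RelIso.mul_apply, hf, RelIso.apply_inv_self]
  intro h
  apply hw
  rw [← RelIso.apply_inv_self g w]
  exact g.map_rel_iff.2 h

/-- Rigid stabilisers of incomparable vertices commute. -/
theorem commute_of_mem_rigidStabilizer {f g : TreeAut X} {u v : List X}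
    (hf : f ∈ rigidStabilizer u) (hg : g ∈ rigidStabilizer v) (huv : ¬ u <+: v)
    (hvu : ¬ v <+: u) : Commute f g := by
  have hdisj : ∀ {w}, u <+: w → ¬ v <+: w := fun h h' =>
    (List.prefix_or_prefix_of_prefix h h').elim huv hvu
  refine RelIso.ext fun w => ?_
  rw [RelIso.mul_apply, RelIso.mul_apply]
  by_cases h : u <+: w
  · rw [hg w (hdisj h), hg _ (hdisj (prefix_apply_of_mem_rigidStabilizer hf h))]
  · rw [hf w h]
    by_cases h' : v <+: w
    · exact hf _ fun h'' => hdisj h'' (prefix_apply_of_mem_rigidStabilizer hg h')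
    · rw [hg w h', hf w h]

theorem not_prefix_of_length_eq {u v : List X} (hl : u.length = v.length) (h : u ≠ v) :
    ¬ u <+: v :=
  fun h' => h (h'.eq_of_length hl)

/-- Rigid stabilisers of distinct vertices of one level intersect trivially. -/
theorem eq_of_mem_rigidStabilizer {f : TreeAut X} {u v : List X} (hl : u.length = v.length)
    (hu : f ∈ rigidStabilizer u) (hv : f ∈ rigidStabilizer v) (hf : f ≠ 1) : u = v := by
  by_contra h
  obtain ⟨w, hw⟩ := exists_apply_ne hf
  have h1 : u <+: w := by_contra fun h' => hw (hu w h')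
  have h2 : v <+: w := by_contra fun h' => hw (hv w h')
  exact not_prefix_of_length_eq hl h (List.prefix_of_prefix_length_le h1 h2 hl.le)

/-! ### Automorphisms supported below a vertex -/

section Below

variable [DecidableEq X]

/-- The automorphism acting as `k` on the subtree below the letter `x` and trivially elsewhere. -/
def belowLetterAut (x : X) (k : TreeAut X) : TreeAut X where
  toFun
    | [] => []
    | y :: w => if y = x then y :: k w else y :: w
  invFun
    | [] => []
    | y :: w => if y = x then y :: k.symm w else y :: w
  left_inv w := by
    cases w with
    | nil => rfl
    | cons y w => by_cases h : y = x <;> simp [h]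
  right_inv w := by
    cases w with
    | nil => rfl
    | cons y w => by_cases h : y = x <;> simp [h]
  map_rel_iff' {v w} := by
    cases v with
    | nil => simp
    | cons y v =>
      cases w with
      | nil => by_cases h : y = x <;> simp [h]
      | cons z w =>
        by_cases h : y = x <;> by_cases h' : z = x <;>
          simp [h, h', List.cons_prefix_cons, k.map_rel_iff]
        intro h''
        exact absurd (h'' ▸ rfl) h'

theorem belowLetterAut_cons (x : X) (k : TreeAut X) (y : X) (w : List X) :
    belowLetterAut x k (y :: w) = if y = x then y :: k w else y :: w :=
  rfl

/-- The embedding `k ↦ belowLetterAut x k` as a group homomorphism. -/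
def belowLetter (x : X) : TreeAut X →* TreeAut X where
  toFun := belowLetterAut x
  map_one' := RelIso.ext fun w => by
    cases w with
    | nil => rfl
    | cons y w => simp [belowLetterAut_cons]
  map_mul' k l := RelIso.ext fun w => by
    cases w with
    | nil => rfl
    | cons y w => by_cases h : y = x <;> simp [belowLetterAut_cons, h]

theorem belowLetter_cons (x : X) (k : TreeAut X) (y : X) (w : List X) :
    belowLetter x k (y :: w) = if y = x then y :: k w else y :: w :=
  rfl

theorem belowLetter_singleton (x : X) (k : TreeAut X) (y : X) : belowLetter x k [y] = [y] := by
  rw [belowLetter_cons, map_nil, ite_self]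

theorem belowLetter_sectionAt (x : X) (k : TreeAut X) (y : X) :
    (belowLetter x k).sectionAt [y] = if y = x then k else 1 := by
  refine RelIso.ext fun w => List.append_cancel_left (as := [y]) ?_
  have h := apply_append_eq_sectionAt (belowLetter x k) [y] w
  rw [belowLetter_singleton, List.singleton_append, belowLetter_cons] at h
  rw [← h]
  split_ifs <;> rfl

/-- The embedding of `TreeAut X` in itself as the automorphisms supported below the vertex `u`. -/
def below : List X → TreeAut X →* TreeAut X
  | [] => MonoidHom.id _
  | x :: u => (belowLetter x).comp (below u)

theorem below_injective (u : List X) : Function.Injective (below u) := by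
  induction u with
  | nil => exact Function.injective_id
  | cons x u ih =>
    intro k l h
    have h' : (belowLetter x (below u k)).sectionAt [x]
        = (belowLetter x (below u l)).sectionAt [x] :=
      congrArg (fun f => sectionAt f [x]) h
    rw [belowLetter_sectionAt, belowLetter_sectionAt, if_pos rfl, if_pos rfl] at h'
    exact ih h'

theorem below_mem_rigidStabilizer (u : List X) (k : TreeAut X) :
    below u k ∈ rigidStabilizer u := by
  induction u with
  | nil => exact fun w hw => absurd (List.nil_prefix) hw
  | cons x u ih =>
    intro w hw
    cases w with
    | nil => exact map_nil _
    | cons y w =>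
      change belowLetter x (below u k) (y :: w) = y :: w
      rw [belowLetter_cons]
      split_ifs with h
      · rw [ih w fun h' => hw (List.cons_prefix_cons.2 ⟨h.symm, h'⟩)]
      · rfl

end Below

end TreeAut

namespace TreeAut

open scoped commutatorElement

variable {X : Type*}

/-! ### Reconstructing the tree from the group -/

/-- Suppose that `A` acts transitively on the levels of the subtree below `u` and has noncommuting
elements in the rigid stabiliser of each vertex of that subtree.  If `g` commutes with all
`A`-conjugates of `h`, then `g` and `h` do not both act nontrivially below `u`: otherwise some
conjugate `h'` of `h` moves a vertex `z` moved by `g`, and for noncommuting `r`, `s` in the rigid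
stabiliser of `z` the nontrivial commutator `⁅⁅g, r⁆, s⁆ = ⁅r⁻¹, s⁆` commutes with `h'` although it
is supported below `z`. -/
theorem fixes_below_or_fixes_below (A : Subgroup (TreeAut X)) (u : List X)
    (htrans : ∀ v w : List X, v.length = w.length → ∃ k ∈ A, k (u ++ v) = u ++ w)
    (hcomm : ∀ z : List X, ∃ r ∈ A ⊓ rigidStabilizer z, ∃ s ∈ A ⊓ rigidStabilizer z,
      r * s ≠ s * r)
    {g h : TreeAut X} (hgh : ∀ y ∈ A, Commute g (y * h * y⁻¹)) :
    (∀ v, g (u ++ v) = u ++ v) ∨ ∀ v, h (u ++ v) = u ++ v := by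
  by_contra! hcon
  obtain ⟨⟨v₁, hv₁⟩, v₂, hv₂⟩ := hcon
  -- Both automorphisms move vertices of the level of `u ++ v₁ ++ v₂`.
  set z := u ++ (v₁ ++ v₂) with hz
  have hgz : g z ≠ z := fun h' =>
    hv₁ (apply_eq_of_prefix ⟨v₂, by rw [hz, List.append_assoc]⟩ h')
  have hhz : h (u ++ (v₂ ++ v₁)) ≠ u ++ (v₂ ++ v₁) := fun h' =>
    hv₂ (apply_eq_of_prefix ⟨v₁, by rw [List.append_assoc]⟩ h')
  obtain ⟨k, hkA, hk⟩ := htrans (v₂ ++ v₁) (v₁ ++ v₂) (by simp [add_comm])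
  set h' := k * h * k⁻¹ with hh'
  have hh'z : h' z ≠ z := by
    intro e
    rw [hh', hz, ← hk, RelIso.mul_apply, RelIso.mul_apply, RelIso.inv_apply_self] at e
    exact hhz (k.injective e)
  obtain ⟨r, ⟨hrA, hrz⟩, s, ⟨hsA, hsz⟩, hrs⟩ := hcomm z
  -- The elements commuting with all `A`-conjugates of `h` form a group normalised by `A`.
  let C : Subgroup (TreeAut X) :=
    { carrier := {c | ∀ y ∈ A, Commute c (y * h * y⁻¹)}
      one_mem' := fun y _ => Commute.one_left _
      mul_mem' := fun hc hd y hy => (hc y hy).mul_left (hd y hy)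
      inv_mem' := fun hc y hy => (hc y hy).inv_left }
  have hC : ∀ c ∈ C, ∀ x ∈ A, x * c * x⁻¹ ∈ C := by
    intro c hc x hx y hy
    have e := (hc (x⁻¹ * y) (A.mul_mem (A.inv_mem hx) hy)).map (MulAut.conj x).toMonoidHom
    convert! e using 1
    simp [mul_assoc]
  have hCcomm : ∀ c ∈ C, ∀ x ∈ A, ⁅c, x⁆ ∈ C := by
    intro c hc x hx
    have e : ⁅c, x⁆ = c * (x * c⁻¹ * x⁻¹) := by simp [commutatorElement_def, mul_assoc]
    rw [e]
    exact C.mul_mem hc (hC _ (C.inv_mem hc) x hx)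
  have hmem : ⁅⁅g, r⁆, s⁆ ∈ C := hCcomm _ (hCcomm g hgh r hrA) s hsA
  have hlen : (g z).length = z.length := length_apply g z
  have hρ := conj_mem_rigidStabilizer hrz g
  have hρcomm : ∀ t ∈ rigidStabilizer z, Commute (g * r * g⁻¹) t := fun t ht =>
    commute_of_mem_rigidStabilizer hρ ht (not_prefix_of_length_eq hlen hgz)
      (not_prefix_of_length_eq hlen.symm hgz.symm)
  have hrsz : ⁅r⁻¹, s⁆ ∈ rigidStabilizer z :=
    commutatorElement_mem ((rigidStabilizer z).inv_mem hrz) hsz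
  have hred : ⁅⁅g, r⁆, s⁆ = ⁅r⁻¹, s⁆ := by
    rw [commutatorElement_def g r, commutatorElement_mul_left_eq_conj_mul,
      (hρcomm s hsz).commutator_eq, mul_one, (hρcomm _ hrsz).eq,
      mul_inv_cancel_right]
  have hne : ⁅r⁻¹, s⁆ ≠ 1 := by
    rw [Ne, commutatorElement_eq_one_iff_commute, Commute.inv_left_iff]
    exact hrs
  have hh'comm : Commute ⁅r⁻¹, s⁆ h' := hred ▸ hmem k hkA
  have hrsz' := conj_mem_rigidStabilizer hrsz h'
  rw [← hh'comm.eq, mul_inv_cancel_right] at hrsz'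
  exact hh'z (eq_of_mem_rigidStabilizer (length_apply h' z) hrsz' hrsz hne)

/-- In a group with nontrivial rigid vertex stabilisers, the centraliser in the full automorphism
group of the tree is trivial: an automorphism moving `z` moves the support of an element of the
rigid stabiliser of `z`. -/
theorem eq_one_of_commute {G : Subgroup (TreeAut X)}
    (hrist : ∀ z : List X, ∃ r ∈ G, r ∈ rigidStabilizer z ∧ r ≠ 1) {c : TreeAut X}
    (hc : ∀ g ∈ G, Commute c g) : c = 1 := by
  by_contra hne
  obtain ⟨z, hz⟩ := exists_apply_ne hne
  obtain ⟨r, hrG, hrz, hr⟩ := hrist z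
  have h := conj_mem_rigidStabilizer hrz c
  rw [(hc r hrG).eq, mul_inv_cancel_right] at h
  exact hz (eq_of_mem_rigidStabilizer (length_apply c z) h hrz hr)

/-- A witness that `G` is a saturated weakly branch group: a decreasing sequence of characteristic
subgroups `H n` of `G` such that `H n` fixes the `n`th level, is transitive on each level of each
subtree below that level, and has noncommuting elements in the rigid stabiliser of every vertex. -/
structure IsSaturating (G : Subgroup (TreeAut X)) (H : ℕ → Subgroup G) : Prop where
  antitone : Antitone H
  characteristic : ∀ n, (H n).Characteristic
  fixes : ∀ n, ∀ g ∈ H n, ∀ w : List X, w.length = n → g.1 w = w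
  transitive : ∀ u v w : List X, v.length = w.length → ∃ g ∈ H u.length, g.1 (u ++ v) = u ++ w
  rigid_noncomm : ∀ (n : ℕ) (z : List X), ∃ r ∈ H n, ∃ s ∈ H n,
    r.1 ∈ rigidStabilizer z ∧ s.1 ∈ rigidStabilizer z ∧ r * s ≠ s * r

namespace IsSaturating

variable {G : Subgroup (TreeAut X)} {H : ℕ → Subgroup G}

theorem apply_mem (hH : IsSaturating G H) (α : MulAut G) {n : ℕ} {g : G} (hg : g ∈ H n) :
    α g ∈ H n := by
  have h := (hH.characteristic n).fixed α
  rw [← h] at hg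
  exact hg

theorem exists_ne_one (hH : IsSaturating G H) (n : ℕ) (z : List X) :
    ∃ r ∈ H n, r.1 ∈ rigidStabilizer z ∧ r ≠ 1 := by
  obtain ⟨r, hr, s, -, hrz, -, hrs⟩ := hH.rigid_noncomm n z
  exact ⟨r, hr, hrz, fun h => hrs (by simp [h])⟩

/-- The images under `α` of rigid stabilisers of distinct vertices `v`, `v'` of one level do not
both act nontrivially below a vertex `u` of that level. -/
theorem eq_of_moves_below (hH : IsSaturating G H) (α : MulAut G) {u v v' w w' : List X}
    (hv : v.length = u.length) (hv' : v'.length = u.length) {r r' : G}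
    (hrv : r.1 ∈ rigidStabilizer v)
    (hrv' : r'.1 ∈ rigidStabilizer v') (hw : u <+: w) (hw' : u <+: w')
    (hrw : (α r).1 w ≠ w) (hrw' : (α r').1 w' ≠ w') : v = v' := by
  by_contra hne
  have key := fixes_below_or_fixes_below ((H u.length).map G.subtype) u ?_ ?_
    (g := (α r).1) (h := (α r').1) ?_
  · obtain ⟨t, rfl⟩ := hw
    obtain ⟨t', rfl⟩ := hw'
    exact key.elim (fun h => hrw (h t)) fun h => hrw' (h t')
  · intro a b hab
    obtain ⟨g, hg, h⟩ := hH.transitive u a b hab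
    exact ⟨g.1, ⟨g, hg, rfl⟩, h⟩
  · intro z
    obtain ⟨r, hr, s, hs, hrz, hsz, hrs⟩ := hH.rigid_noncomm u.length z
    exact ⟨r.1, ⟨⟨r, hr, rfl⟩, hrz⟩, s.1, ⟨⟨s, hs, rfl⟩, hsz⟩, fun h => hrs (Subtype.ext h)⟩
  · rintro _ ⟨y, hy, rfl⟩
    -- Write `y = α y'`; then `y'` fixes `v'`, so `y' * r' * y'⁻¹` is still supported below `v'`.
    have hy' : α.symm y ∈ H u.length := hH.apply_mem α.symm hy
    have h := conj_mem_rigidStabilizer hrv' (α.symm y).1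
    rw [hH.fixes _ _ hy' _ hv'] at h
    have hcomm : Commute r (α.symm y * r' * (α.symm y)⁻¹) :=
      Subtype.ext (commute_of_mem_rigidStabilizer hrv h
        (not_prefix_of_length_eq (hv.trans hv'.symm) hne)
        (not_prefix_of_length_eq (hv'.trans hv.symm) (Ne.symm hne))).eq
    have h2 := (hcomm.map α.toMonoidHom).map G.subtype
    simpa using h2

variable [Finite X]

/-- An automorphism `α` of `G` permutes the supports: it maps the part of `H n` supported below a
vertex `v` of level `n` into the rigid stabiliser of a vertex of the same level.  The sets of
vertices of level `n` below which the images of these parts act are nonempty and pairwise disjoint,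
hence singletons as the level is finite. -/
theorem exists_image (hH : IsSaturating G H) (α : MulAut G) (v : List X) :
    ∃ u : List X, u.length = v.length ∧
      ∀ r ∈ H v.length, r.1 ∈ rigidStabilizer v → (α r).1 ∈ rigidStabilizer u := by
  set n := v.length with hn
  have hmoves : ∀ x : {x : List X // x.length = n}, ∃ u : {u : List X // u.length = n},
      ∃ r ∈ H n, r.1 ∈ rigidStabilizer x.1 ∧ ∃ w, u.1 <+: w ∧ (α r).1 w ≠ w := by
    rintro ⟨x, hx⟩
    obtain ⟨r, hr, hrx, hr1⟩ := hH.exists_ne_one n x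
    obtain ⟨w, hw⟩ := exists_apply_ne (f := (α r).1) fun h =>
      hr1 ((map_eq_one_iff α α.injective).1 (Subtype.ext h))
    have hw' : (α r).1 (w ++ x) ≠ w ++ x := fun h =>
      hw (apply_eq_of_prefix (List.prefix_append w x) h)
    exact ⟨⟨(w ++ x).take n, by simp [hx]⟩, r, hr, hrx, w ++ x, List.take_prefix _ _, hw'⟩
  -- `p x` is a vertex of level `n` below which the image of some `r` supported below `x` acts.
  choose p hp using hmoves
  have huniq : ∀ x y : {x : List X // x.length = n}, ∀ r : G, r.1 ∈ rigidStabilizer y.1 →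
      ∀ w, (p x).1 <+: w → (α r).1 w ≠ w → x = y := by
    intro x y r hry w hw hrw
    obtain ⟨r', -, hrx, w', hw', hrw'⟩ := hp x
    have hl := (p x).2
    exact Subtype.ext (hH.eq_of_moves_below α (x.2.trans hl.symm) (y.2.trans hl.symm) hrx hry
      hw' hw hrw' hrw)
  have : Finite {x : List X // x.length = n} := List.finite_length_eq X n
  have hinj : Function.Injective p := by
    intro x y hxy
    obtain ⟨r, -, hry, w, hw, hrw⟩ := hp y
    exact huniq x y r hry w (hxy ▸ hw) hrw
  refine ⟨p ⟨v, rfl⟩, (p _).2, fun r hr hrv w hw => ?_⟩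
  by_contra hrw
  have hlong : (α r).1 (w ++ v) ≠ w ++ v := fun h =>
    hrw (apply_eq_of_prefix (List.prefix_append w v) h)
  obtain ⟨x, hx⟩ := (Finite.surjective_of_injective hinj) ⟨(w ++ v).take n, by simp [hn]⟩
  have hx' : (p x).1 = (w ++ v).take n := congrArg Subtype.val hx
  have hxv := huniq x ⟨v, rfl⟩ r hrv (w ++ v) (hx' ▸ List.take_prefix _ _) hlong
  rw [hxv] at hx'
  -- A word of length at most `n` is fixed, being a prefix of a fixed word of length `n`.
  rcases le_total n w.length with h | h
  · rw [List.take_append_of_le_length h] at hx'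
    exact hw (hx' ▸ List.take_prefix _ _)
  · refine hrw (apply_eq_of_prefix (w := (w ++ v).take n) ?_
      (hH.fixes n _ (hH.apply_mem α hr) _ (by simp [hn])))
    exact List.prefix_of_prefix_length_le (List.prefix_append w v) (List.take_prefix _ _)
      (by simpa [hn] using h)

/-- The map on vertices induced by an automorphism of `G`. -/
noncomputable def vertexMap (hH : IsSaturating G H) (α : MulAut G) (v : List X) : List X :=
  (hH.exists_image α v).choose

theorem length_vertexMap (hH : IsSaturating G H) (α : MulAut G) (v : List X) :
    (hH.vertexMap α v).length = v.length :=
  (hH.exists_image α v).choose_spec.1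

theorem mem_rigidStabilizer_vertexMap (hH : IsSaturating G H) (α : MulAut G) {v : List X} {r : G}
    (hr : r ∈ H v.length) (hrv : r.1 ∈ rigidStabilizer v) :
    (α r).1 ∈ rigidStabilizer (hH.vertexMap α v) :=
  (hH.exists_image α v).choose_spec.2 r hr hrv

theorem vertexMap_symm_vertexMap (hH : IsSaturating G H) (α : MulAut G) (v : List X) :
    hH.vertexMap α.symm (hH.vertexMap α v) = v := by
  obtain ⟨r, hr, hrv, hr1⟩ := hH.exists_ne_one v.length v
  have h := hH.mem_rigidStabilizer_vertexMap α.symm (v := hH.vertexMap α v)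
    (by rw [length_vertexMap]; exact hH.apply_mem α hr)
    (hH.mem_rigidStabilizer_vertexMap α hr hrv)
  rw [MulEquiv.symm_apply_apply] at h
  exact eq_of_mem_rigidStabilizer (by simp [length_vertexMap]) h hrv fun h' =>
    hr1 (Subtype.ext h')

theorem vertexMap_prefix (hH : IsSaturating G H) (α : MulAut G) {v w : List X} (h : v <+: w) :
    hH.vertexMap α v <+: hH.vertexMap α w := by
  obtain ⟨r, hr, hrw, hr1⟩ := hH.exists_ne_one w.length w
  have h1 := hH.mem_rigidStabilizer_vertexMap α hr hrw
  have h2 := hH.mem_rigidStabilizer_vertexMap α (hH.antitone h.length_le hr)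
    (rigidStabilizer_anti h hrw)
  obtain ⟨t, ht⟩ := exists_apply_ne (f := (α r).1) fun h =>
    hr1 ((map_eq_one_iff α α.injective).1 (Subtype.ext h))
  refine List.prefix_of_prefix_length_le (l₃ := t) (by_contra fun h' => ht (h2 t h'))
    (by_contra fun h' => ht (h1 t h')) ?_
  rw [length_vertexMap, length_vertexMap]
  exact h.length_le

/-- The tree automorphism that induces a given automorphism of `G`. -/
noncomputable def treeAut (hH : IsSaturating G H) (α : MulAut G) : TreeAut X where
  toFun := hH.vertexMap α
  invFun := hH.vertexMap α.symm
  left_inv := hH.vertexMap_symm_vertexMap α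
  right_inv := hH.vertexMap_symm_vertexMap α.symm
  map_rel_iff' {v w} := by
    refine ⟨fun h => ?_, fun h => hH.vertexMap_prefix α h⟩
    have h' := hH.vertexMap_prefix α.symm h
    change hH.vertexMap α.symm (hH.vertexMap α v) <+: hH.vertexMap α.symm (hH.vertexMap α w) at h'
    rwa [vertexMap_symm_vertexMap, vertexMap_symm_vertexMap] at h'

theorem treeAut_conj (hH : IsSaturating G H) (α : MulAut G) (g : G) :
    hH.treeAut α * g.1 = (α g).1 * hH.treeAut α := by
  refine RelIso.ext fun v => ?_
  change hH.vertexMap α (g.1 v) = (α g).1 (hH.vertexMap α v)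
  obtain ⟨r, hr, hrv, hr1⟩ := hH.exists_ne_one v.length v
  have hnormal : (H v.length).Normal :=
    have := hH.characteristic v.length
    inferInstance
  have h1 := hH.mem_rigidStabilizer_vertexMap α (v := g.1 v) (r := g * r * g⁻¹)
    (by rw [length_apply]; exact hnormal.conj_mem r hr g) (conj_mem_rigidStabilizer hrv g.1)
  have h2 := conj_mem_rigidStabilizer (hH.mem_rigidStabilizer_vertexMap α hr hrv) (α g).1
  rw [map_mul, map_mul, map_inv] at h1
  refine eq_of_mem_rigidStabilizer (by simp [length_vertexMap, length_apply]) h1 h2 fun h => hr1 ?_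
  have h3 : α (g * r * g⁻¹) = 1 := by
    rw [map_mul, map_mul, map_inv]
    exact Subtype.ext h
  rwa [map_eq_one_iff α α.injective, conj_eq_one_iff] at h3

/-- Every automorphism of a saturated weakly branch group is induced by conjugation by a unique
element of its normaliser in the automorphism group of the tree. -/
theorem bijective_normalizerMonoidHom (hH : IsSaturating G H) :
    Function.Bijective G.normalizerMonoidHom := by
  constructor
  · rw [← MonoidHom.ker_eq_bot_iff, eq_bot_iff]
    intro c hc
    refine Subtype.ext (eq_one_of_commute (G := G) (fun z => ?_) fun g hg => ?_)
    · obtain ⟨r, -, hrz, hr⟩ := hH.exists_ne_one 0 z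
      exact ⟨r.1, r.2, hrz, fun h => hr (Subtype.ext h)⟩
    · rw [Subgroup.normalizerMonoidHom_ker, Subgroup.mem_subgroupOf] at hc
      exact (Subgroup.mem_centralizer_iff.1 hc g hg).symm
  · intro α
    have hconj : ∀ g : G, hH.treeAut α * g.1 * (hH.treeAut α)⁻¹ = (α g).1 := fun g => by
      rw [treeAut_conj, mul_inv_cancel_right]
    refine ⟨⟨hH.treeAut α, ?_⟩, ?_⟩
    · rw [Subgroup.mem_normalizer_iff]
      refine fun g => ⟨fun hg => hconj ⟨g, hg⟩ ▸ (α ⟨g, hg⟩).2, fun hg => ?_⟩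
      have h := hconj (α.symm ⟨_, hg⟩)
      rw [MulEquiv.apply_symm_apply] at h
      have h' := mul_left_cancel (mul_right_cancel h)
      exact h' ▸ (α.symm ⟨_, hg⟩).2
    · refine MulEquiv.ext fun g => Subtype.ext ?_
      rw [← hconj g]
      rfl

end IsSaturating

end TreeAut

namespace SecondGrigorchuk

open TreeAut
open scoped commutatorElement

/-! ### The generators of the second Grigorchuk group -/

/-- Induction along the rotation of the alphabet. -/
theorem letter_induction {p : Fin 4 → Prop} (h0 : p 0) (h : ∀ x, p x → p (x + 1)) (x : Fin 4) :
    p x := by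
  have h1 := h 0 h0
  have h2 := h _ h1
  have h3 := h _ h2
  fin_cases x
  exacts [h0, h1, h2, h3]

theorem a_singleton (x : Fin 4) : a [x] = [x + 1] := by
  rw [a, rooted_singleton, finRotate_apply]

theorem a_sectionAt (x : Fin 4) : a.sectionAt [x] = 1 :=
  rooted_sectionAt _ x

theorem a_mem : a ∈ group :=
  Subgroup.subset_closure (by simp)

theorem b_mem : b ∈ group :=
  Subgroup.subset_closure (by simp)

theorem b_singleton (x : Fin 4) : b [x] = [x] := by
  fin_cases x <;> rfl

theorem b_sectionAt_zero : b.sectionAt [0] = a :=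
  RelIso.ext fun _ => rfl

theorem b_sectionAt_one : b.sectionAt [1] = 1 :=
  RelIso.ext fun _ => rfl

theorem b_sectionAt_two : b.sectionAt [2] = a :=
  RelIso.ext fun _ => rfl

theorem b_sectionAt_three : b.sectionAt [3] = b :=
  RelIso.ext fun _ => rfl

theorem conj_a_singleton {f : TreeAut (Fin 4)} (hf : ∀ x, f [x] = [x]) (x : Fin 4) :
    (a * f * a⁻¹) [x] = [x] := by
  have h := conj_apply_of_fixed (hf (x - 1)) a
  rwa [a_singleton, sub_add_cancel] at h

/-- Conjugation by `a` rotates the first level sections. -/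
theorem conj_a_sectionAt {f : TreeAut (Fin 4)} {x : Fin 4} (hf : f [x] = [x]) :
    (a * f * a⁻¹).sectionAt [x + 1] = f.sectionAt [x] := by
  have h := conj_sectionAt hf a
  rwa [a_singleton, a_sectionAt, one_mul, inv_one, mul_one] at h

/-- The automorphisms whose first level sections lie in the group and that rotate the first level.
They form a subgroup, which contains the second Grigorchuk group. -/
def rotating : Subgroup (TreeAut (Fin 4)) where
  carrier := {f | (∃ k : Fin 4, ∀ x, f [x] = [x + k]) ∧ ∀ x : Fin 4, f.sectionAt [x] ∈ group}
  one_mem' := ⟨⟨0, fun x => by rw [add_zero]; rfl⟩,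
    fun x => by rw [one_sectionAt]; exact group.one_mem⟩
  mul_mem' := by
    rintro f g ⟨⟨k, hk⟩, hf⟩ ⟨⟨l, hl⟩, hg⟩
    refine ⟨⟨l + k, fun x => by rw [RelIso.mul_apply, hl, hk, add_assoc]⟩, fun x => ?_⟩
    rw [mul_sectionAt, hl]
    exact group.mul_mem (hf _) (hg x)
  inv_mem' := by
    rintro f ⟨⟨k, hk⟩, hf⟩
    have hinv : ∀ x, f⁻¹ [x] = [x + -k] := fun x => by
      have h : f [x + -k] = [x] := by rw [hk, neg_add_cancel_right]
      rw [← h, RelIso.inv_apply_self]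
    refine ⟨⟨-k, hinv⟩, fun x => ?_⟩
    have h : f [x + -k] = [x] := by rw [hk, neg_add_cancel_right]
    rw [← h, inv_sectionAt_apply]
    exact group.inv_mem (hf _)

theorem group_le_rotating : group ≤ rotating := by
  rw [group, Subgroup.closure_le]
  rintro f (rfl | rfl)
  · exact ⟨⟨1, a_singleton⟩, fun x => by rw [a_sectionAt]; exact group.one_mem⟩
  · refine ⟨⟨0, fun x => by rw [b_singleton, add_zero]⟩, fun x => ?_⟩
    fin_cases x
    · exact b_sectionAt_zero ▸ a_mem
    · exact b_sectionAt_one ▸ group.one_mem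
    · exact b_sectionAt_two ▸ a_mem
    · exact b_sectionAt_three ▸ b_mem

theorem sectionAt_mem {f : TreeAut (Fin 4)} (hf : f ∈ group) (u : List (Fin 4)) :
    f.sectionAt u ∈ group := by
  induction u generalizing f with
  | nil => rwa [sectionAt_nil]
  | cons x u ih =>
    have h := sectionAt_sectionAt f [x] u
    rw [List.singleton_append] at h
    exact h ▸ ih ((group_le_rotating hf).2 x)

/-! ### The derived series -/

/-- The derived series of the second Grigorchuk group, as subgroups of `TreeAut (Fin 4)`. -/
def derived (n : ℕ) : Subgroup (TreeAut (Fin 4)) :=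
  (derivedSeries group n).map group.subtype

theorem derived_zero : derived 0 = group := by
  rw [derived, derivedSeries_zero, ← MonoidHom.range_eq_map, Subgroup.range_subtype]

theorem derived_succ (n : ℕ) : derived (n + 1) = ⁅derived n, derived n⁆ := by
  rw [derived, derivedSeries_succ, Subgroup.map_commutator, derived]

theorem derived_le_group (n : ℕ) : derived n ≤ group :=
  Subgroup.map_subtype_le _

theorem conj_mem_derived {n : ℕ} {f g : TreeAut (Fin 4)} (hf : f ∈ derived n) (hg : g ∈ group) :
    g * f * g⁻¹ ∈ derived n := by
  obtain ⟨f, hf, rfl⟩ := hf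
  exact ⟨⟨g, hg⟩ * f * ⟨g, hg⟩⁻¹,
    (derivedSeries_normal group n).conj_mem f hf ⟨g, hg⟩, rfl⟩

theorem derived_le_firstLevel (n : ℕ) : derived (n + 1) ≤ firstLevel fun _ => derived n := by
  induction n with
  | zero =>
    rw [derived_succ, derived_zero, Subgroup.commutator_le]
    intro f hf g hg x
    obtain ⟨⟨k, hk⟩, -⟩ := group_le_rotating hf
    obtain ⟨⟨l, hl⟩, -⟩ := group_le_rotating hg
    refine ⟨?_, sectionAt_mem (commutatorElement_mem hf hg) _⟩
    -- The rotations of the first level commute.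
    obtain ⟨y, rfl⟩ : ∃ y, x = y + (k + l) := ⟨x - (k + l), (sub_add_cancel x _).symm⟩
    have e : [y + (k + l)] = g (f [y]) := by rw [hk, hl, add_assoc]
    have e' : [y + (k + l)] = f (g [y]) := by rw [hl, hk, add_assoc, add_comm l]
    conv_lhs => rw [e]
    rw [commutatorElement_def, RelIso.mul_apply, RelIso.mul_apply, RelIso.mul_apply,
      RelIso.inv_apply_self, RelIso.inv_apply_self, e']
  | succ n ih =>
    rw [derived_succ (n + 1)]
    refine (Subgroup.commutator_mono ih ih).trans ((commutator_firstLevel_le _ _).trans ?_)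
    rw [derived_succ n]

/-- The `n`th derived subgroup fixes the `n`th level of the tree. -/
theorem derived_fixes {n : ℕ} {f : TreeAut (Fin 4)} (hf : f ∈ derived n) {w : List (Fin 4)}
    (hw : w.length = n) : f w = w := by
  induction n generalizing f w with
  | zero => rw [List.length_eq_zero_iff.1 hw, map_nil]
  | succ n ih =>
    obtain ⟨x, w, rfl⟩ := List.exists_cons_of_length_eq_add_one hw
    obtain ⟨h1, h2⟩ := derived_le_firstLevel n hf x
    rw [← List.singleton_append, apply_append_eq_sectionAt, h1,
      ih h2 (by simpa using hw)]

theorem sections_le_add_one {H : Subgroup (TreeAut (Fin 4))} (hH : ∀ f ∈ H, a * f * a⁻¹ ∈ H)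
    (x : Fin 4) : sections H [x] ≤ sections H [x + 1] := by
  rintro _ ⟨f, hf, hfx, rfl⟩
  refine ⟨a * f * a⁻¹, hH f hf, ?_, conj_a_sectionAt hfx⟩
  have h := conj_apply_of_fixed hfx a
  rwa [a_singleton] at h

theorem sections_le_sections {H : Subgroup (TreeAut (Fin 4))} (hH : ∀ f ∈ H, a * f * a⁻¹ ∈ H)
    (x y : Fin 4) : sections H [x] ≤ sections H [y] := by
  have key : ∀ k, sections H [x] ≤ sections H [x + k] :=
    letter_induction (by rw [add_zero]) fun k ih => by
      rw [← add_assoc]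
      exact ih.trans (sections_le_add_one hH _)
  have h := key (y - x)
  rwa [add_sub_cancel] at h

/-- Each first level section of the commutator subgroup is the whole group: `⁅a, b⁆` has the
sections `b * a⁻¹` and `a` at the first two letters, and conjugation by `a` moves these to any
other letter. -/
theorem group_le_sections_derived_one (x : Fin 4) : group ≤ sections (derived 1) [x] := by
  have hconj : ∀ f ∈ derived 1, a * f * a⁻¹ ∈ derived 1 := fun f hf => conj_mem_derived hf a_mem
  have hc : ⁅a, b⁆ ∈ derived 1 := by
    rw [derived_succ, derived_zero]
    exact Subgroup.commutator_mem_commutator a_mem b_mem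
  have hs : ∀ y : Fin 4, ⁅a, b⁆.sectionAt [y + 1] = b.sectionAt [y] * (b.sectionAt [y + 1])⁻¹ := by
    intro y
    rw [commutatorElement_def, mul_sectionAt, inv_apply_of_fixed (b_singleton _),
      inv_sectionAt (b_singleton _), conj_a_sectionAt (b_singleton _)]
  have hmem : ∀ y : Fin 4, b.sectionAt [y] * (b.sectionAt [y + 1])⁻¹ ∈ sections (derived 1) [x] :=
    fun y => sections_le_sections hconj (y + 1) x
      ⟨_, hc, (derived_le_firstLevel 0 hc _).1, hs y⟩
  have ha : a ∈ sections (derived 1) [x] := by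
    have h := hmem 0
    rwa [zero_add, b_sectionAt_zero, b_sectionAt_one, inv_one, mul_one] at h
  have hb : b ∈ sections (derived 1) [x] := by
    have h := hmem 3
    rw [show (3 : Fin 4) + 1 = 0 from rfl, b_sectionAt_zero, b_sectionAt_three] at h
    simpa using mul_mem h ha
  rw [group, Subgroup.closure_le]
  rintro f (rfl | rfl)
  exacts [ha, hb]

theorem derived_le_sections (n : ℕ) (x : Fin 4) : derived n ≤ sections (derived (n + 1)) [x] := by
  induction n with
  | zero => exact derived_zero ▸ group_le_sections_derived_one x
  | succ n ih =>
    rw [derived_succ n, derived_succ (n + 1)]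
    exact (Subgroup.commutator_mono ih ih).trans (commutator_sections_le _ _ _)

/-- The section at a vertex of level `n` maps the `n`th derived subgroup onto the whole group. -/
theorem group_le_sections_derived (u : List (Fin 4)) : group ≤ sections (derived u.length) u := by
  induction u with
  | nil => exact fun f hf => ⟨f, derived_zero.symm ▸ hf, map_nil f, sectionAt_nil f⟩
  | cons x u ih =>
    exact ih.trans ((sections_mono (derived_le_sections _ x) u).trans (sections_sections_le _ _ _))

theorem isSuperStronglyFractal : IsSuperStronglyFractal group := by
  rintro n u rfl
  refine Set.Subset.antisymm ?_ fun g hg => ?_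
  · rintro _ ⟨f, hf, rfl⟩
    exact sectionAt_mem hf.1 u
  · obtain ⟨f, hf, -, h⟩ := group_le_sections_derived u hg
    exact ⟨f, ⟨derived_le_group _ hf, fun w hw => derived_fixes hf hw⟩, h⟩

/-! ### Level transitivity and rigid stabilisers -/

theorem exists_apply_singleton (x y : Fin 4) : ∃ g ∈ group, g [x] = [y] := by
  have key : ∀ k, ∃ g ∈ group, g [x] = [x + k] :=
    letter_induction ⟨1, group.one_mem, by rw [add_zero]; rfl⟩ fun k ⟨g, hg, h⟩ =>
      ⟨a * g, mul_mem a_mem hg, by rw [RelIso.mul_apply, h, a_singleton, add_assoc]⟩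
  have h := key (y - x)
  rwa [add_sub_cancel] at h

theorem exists_apply_eq {v w : List (Fin 4)} (h : v.length = w.length) :
    ∃ g ∈ group, g v = w := by
  induction w generalizing v with
  | nil => exact ⟨1, group.one_mem, List.length_eq_zero_iff.1 h⟩
  | cons y w ih =>
    obtain ⟨x, v, rfl⟩ := List.exists_cons_of_length_eq_add_one h
    obtain ⟨g, hg, hgx⟩ := exists_apply_singleton x y
    obtain ⟨k, hk, hkw⟩ := ih (v := g.sectionAt [x] v) (by simpa [length_apply] using h)
    obtain ⟨f, hf, hfy, rfl⟩ := group_le_sections_derived_one y hk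
    refine ⟨f * g, mul_mem (derived_le_group 1 hf) hg, ?_⟩
    rw [RelIso.mul_apply, ← List.singleton_append, apply_append_eq_sectionAt, hgx,
      apply_append_eq_sectionAt, hfy, hkw, List.singleton_append]

/-- The second derived subgroup, acting below the first letter, is contained in the group.  With
`b₁ = a * b * a⁻¹` and `b₂ = a * b₁ * a⁻¹`, the elements `⁅b, b₁⁆` and `⁅b₁, b₂⁆` of the group have
the first level sections `(⁅a, b⁆, 1, 1, *)` and `(⁅b, a⁆, *, 1, 1)`.  Hence each element of the
commutator subgroup occurs as the section at the first letter both of an element of the group with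
trivial sections at the second and the third letter, and of one with trivial sections at the third
and the fourth, and the commutator of two such elements has only one nontrivial section. -/
theorem map_belowLetter_zero_derived_two_le : (derived 2).map (belowLetter 0) ≤ group := by
  -- `firstLevel (K z)` consists of the automorphisms with trivial sections at `z` and at `2`.
  let K : Fin 4 → Fin 4 → Subgroup (TreeAut (Fin 4)) := fun z x =>
    if x = z ∨ x = 2 then ⊥ else ⊤
  have hnormal : ∀ z, ∀ g ∈ group, ∀ k ∈ sections (group ⊓ firstLevel (K z)) [0],
      g * k * g⁻¹ ∈ sections (group ⊓ firstLevel (K z)) [0] := by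
    rintro z g hg _ ⟨f, ⟨hf, hfK⟩, hf0, rfl⟩
    obtain ⟨l, hl, hl0, rfl⟩ := group_le_sections_derived_one 0 hg
    have hl1 := fun x => (derived_le_firstLevel 0 hl x).1
    have hlG := derived_le_group 1 hl
    have h0 : ∀ x, (l * f * l⁻¹) [x] = [x] := fun x => by
      have h := conj_apply_of_fixed (hfK x).1 l
      rwa [hl1] at h
    have h1 : ∀ x, (l * f * l⁻¹).sectionAt [x]
        = l.sectionAt [x] * f.sectionAt [x] * (l.sectionAt [x])⁻¹ := fun x => by
      have h := conj_sectionAt (hfK x).1 l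
      rwa [hl1] at h
    refine ⟨l * f * l⁻¹, ⟨group.mul_mem (group.mul_mem hlG hf) (group.inv_mem hlG),
      fun x => ⟨h0 x, ?_⟩⟩, h0 0, h1 0⟩
    rw [h1]
    have hK : (K z x).Normal := by
      dsimp only [K]
      split_ifs <;> infer_instance
    exact hK.conj_mem _ (hfK x).2 _
  have hle : ∀ z, ⁅a, b⁆ ∈ sections (group ⊓ firstLevel (K z)) [0] →
      derived 1 ≤ sections (group ⊓ firstLevel (K z)) [0] := by
    intro z hz
    rw [derived_succ, derived_zero]
    refine commutator_closure_le (hnormal z) ?_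
    rintro s (rfl | rfl) t (rfl | rfl)
    · rw [commutatorElement_self]; exact one_mem _
    · exact hz
    · rw [← commutatorElement_inv]; exact inv_mem hz
    · rw [commutatorElement_self]; exact one_mem _
  set b₁ := a * b * a⁻¹ with hb₁
  set b₂ := a * b₁ * a⁻¹ with hb₂
  have hb₁G : b₁ ∈ group := mul_mem (mul_mem a_mem b_mem) (inv_mem a_mem)
  have hb₂G : b₂ ∈ group := mul_mem (mul_mem a_mem hb₁G) (inv_mem a_mem)
  have hb₁x : ∀ x, b₁ [x] = [x] := conj_a_singleton b_singleton
  have hb₂x : ∀ x, b₂ [x] = [x] := conj_a_singleton hb₁x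
  have h10 : b₁.sectionAt [0] = b := (conj_a_sectionAt (b_singleton 3)).trans b_sectionAt_three
  have h11 : b₁.sectionAt [1] = a := (conj_a_sectionAt (b_singleton 0)).trans b_sectionAt_zero
  have h12 : b₁.sectionAt [2] = 1 := (conj_a_sectionAt (b_singleton 1)).trans b_sectionAt_one
  have h13 : b₁.sectionAt [3] = a := (conj_a_sectionAt (b_singleton 2)).trans b_sectionAt_two
  have h20 : b₂.sectionAt [0] = a := (conj_a_sectionAt (hb₁x 3)).trans h13
  have h22 : b₂.sectionAt [2] = a := (conj_a_sectionAt (hb₁x 1)).trans h11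
  have h23 : b₂.sectionAt [3] = 1 := (conj_a_sectionAt (hb₁x 2)).trans h12
  have hP : derived 1 ≤ sections (group ⊓ firstLevel (K 1)) [0] := by
    refine hle 1 ⟨⁅b, b₁⁆, ⟨?_, fun x => ⟨?_, ?_⟩⟩, ?_, ?_⟩
    · exact commutatorElement_mem b_mem hb₁G
    · exact commutator_apply_of_fixed (b_singleton x) (hb₁x x)
    · rw [commutator_sectionAt (b_singleton x) (hb₁x x)]
      fin_cases x <;> simp [K, b_sectionAt_one, h12]
    · exact commutator_apply_of_fixed (b_singleton 0) (hb₁x 0)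
    · rw [commutator_sectionAt (b_singleton 0) (hb₁x 0), b_sectionAt_zero, h10]
  have hQ : derived 1 ≤ sections (group ⊓ firstLevel (K 3)) [0] := by
    refine hle 3 ?_
    rw [← commutatorElement_inv]
    refine inv_mem ⟨⁅b₁, b₂⁆, ⟨?_, fun x => ⟨?_, ?_⟩⟩, ?_, ?_⟩
    · exact commutatorElement_mem hb₁G hb₂G
    · exact commutator_apply_of_fixed (hb₁x x) (hb₂x x)
    · rw [commutator_sectionAt (hb₁x x) (hb₂x x)]
      fin_cases x <;> simp [K, h12, h23]
    · exact commutator_apply_of_fixed (hb₁x 0) (hb₂x 0)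
    · rw [commutator_sectionAt (hb₁x 0) (hb₂x 0), h10, h20]
  rw [Subgroup.map_le_iff_le_comap, derived_succ]
  refine (Subgroup.commutator_mono hP hQ).trans ?_
  rw [Subgroup.commutator_le]
  rintro _ ⟨f, ⟨hf, hfK⟩, hf0, rfl⟩ _ ⟨g, ⟨hg, hgK⟩, hg0, rfl⟩
  have hfg : belowLetter 0 ⁅f.sectionAt [0], g.sectionAt [0]⁆ = ⁅f, g⁆ := by
    refine ext_firstLevel (fun x => ?_) fun x => ?_
    · rw [belowLetter_singleton, commutator_apply_of_fixed (hfK x).1 (hgK x).1]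
    · rw [belowLetter_sectionAt, commutator_sectionAt (hfK x).1 (hgK x).1]
      have hf1 : f.sectionAt [1] = 1 := Subgroup.mem_bot.1 (hfK 1).2
      have hf2 : f.sectionAt [2] = 1 := Subgroup.mem_bot.1 (hfK 2).2
      have hg3 : g.sectionAt [3] = 1 := Subgroup.mem_bot.1 (hgK 3).2
      match x with
      | 0 => rw [if_pos rfl]
      | 1 => rw [if_neg (by decide), hf1, commutatorElement_one_left]
      | 2 => rw [if_neg (by decide), hf2, commutatorElement_one_left]
      | 3 => rw [if_neg (by decide), hg3, commutatorElement_one_right]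
  rw [Subgroup.mem_comap, hfg]
  exact commutatorElement_mem hf hg

theorem map_belowLetter_derived_two_le (x : Fin 4) : (derived 2).map (belowLetter x) ≤ group := by
  refine letter_induction (p := fun x => (derived 2).map (belowLetter x) ≤ group)
    map_belowLetter_zero_derived_two_le (fun x ih => ?_) x
  rintro _ ⟨f, hf, rfl⟩
  have h : belowLetter (x + 1) f = a * belowLetter x f * a⁻¹ := by
    refine ext_firstLevel (fun y => ?_) fun y => ?_
    · rw [belowLetter_singleton, conj_a_singleton (belowLetter_singleton _ _)]
    · obtain ⟨y, rfl⟩ : ∃ z, y = z + 1 := ⟨y - 1, (sub_add_cancel y 1).symm⟩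
      rw [conj_a_sectionAt (belowLetter_singleton _ _ _), belowLetter_sectionAt,
        belowLetter_sectionAt]
      simp only [add_left_inj]
  rw [h]
  exact mul_mem (mul_mem a_mem (ih ⟨f, hf, rfl⟩)) (inv_mem a_mem)

theorem map_belowLetter_derived_le (m : ℕ) (x : Fin 4) :
    (derived (m + 2)).map (belowLetter x) ≤ derived m := by
  induction m with
  | zero => exact derived_zero ▸ map_belowLetter_derived_two_le x
  | succ m ih =>
    rw [derived_succ m, add_right_comm, derived_succ (m + 2), Subgroup.map_commutator]
    exact Subgroup.commutator_mono ih ih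

theorem map_below_derived_le (m : ℕ) (u : List (Fin 4)) :
    (derived (m + 2 * u.length)).map (below u) ≤ derived m := by
  induction u generalizing m with
  | nil => exact (Subgroup.map_id _).le
  | cons x u ih =>
    rintro _ ⟨f, hf, rfl⟩
    refine map_belowLetter_derived_le m x ⟨below u f, ih (m + 2) ⟨f, ?_, rfl⟩, rfl⟩
    rwa [List.length_cons, Nat.mul_succ, add_comm (2 * _), ← add_assoc] at hf

theorem exists_mul_ne_mul (n : ℕ) : ∃ r ∈ derived n, ∃ s ∈ derived n, r * s ≠ s * r := by
  by_contra! h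
  have hbot : derived (n + 1) ≤ ⊥ := by
    rw [derived_succ, Subgroup.commutator_le]
    exact fun f hf g hg => commutatorElement_eq_one_iff_mul_comm.2 (h f hf g hg)
  have hlen : (List.replicate (n + 1) (0 : Fin 4)).length = n + 1 := List.length_replicate
  obtain ⟨f, hf, -, hfa⟩ := group_le_sections_derived (List.replicate (n + 1) 0) a_mem
  rw [hlen] at hf
  rw [Subgroup.mem_bot.1 (hbot hf), one_sectionAt] at hfa
  have h0 := a_singleton 0
  rw [← hfa] at h0
  exact absurd h0 (by decide)

/-- The derived series shows that the second Grigorchuk group is saturated and weakly branch. -/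
theorem isSaturating_derivedSeries : IsSaturating group fun n => derivedSeries group n where
  antitone := derivedSeries_antitone group
  characteristic _ := inferInstance
  fixes n g hg w hw := derived_fixes (Subgroup.mem_map_of_mem group.subtype hg) hw
  transitive u v w h := by
    obtain ⟨k, hk, hkv⟩ := exists_apply_eq h
    obtain ⟨_, ⟨f, hf, rfl⟩, hfu, rfl⟩ := group_le_sections_derived u hk
    refine ⟨f, hf, ?_⟩
    rw [apply_append_eq_sectionAt]
    exact congrArg₂ _ hfu hkv
  rigid_noncomm n z := by
    obtain ⟨r, hr, s, hs, hrs⟩ := exists_mul_ne_mul (n + 2 * z.length)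
    obtain ⟨r', hr', hrz⟩ := map_below_derived_le n z ⟨r, hr, rfl⟩
    obtain ⟨s', hs', hsz⟩ := map_below_derived_le n z ⟨s, hs, rfl⟩
    refine ⟨r', hr', s', hs', ?_, ?_, fun h => hrs ?_⟩
    · have h := below_mem_rigidStabilizer z r
      rwa [← hrz] at h
    · have h := below_mem_rigidStabilizer z s
      rwa [← hsz] at h
    · apply below_injective z
      have h' := congrArg group.subtype h
      rw [map_mul, map_mul, hrz, hsz] at h'
      rw [map_mul, map_mul, h']

end SecondGrigorchuk

theorem propositionB :
    TreeAut.IsSuperStronglyFractal SecondGrigorchuk.group ∧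
    Function.Bijective (SecondGrigorchuk.group.normalizerMonoidHom) :=
  ⟨SecondGrigorchuk.isSuperStronglyFractal,
    SecondGrigorchuk.isSaturating_derivedSeries.bijective_normalizerMonoidHom⟩
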